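/- All graphs are finite and simple. Intervals are nonempty closed intervals $[\ell,r]\subset\mathbb R$ ($\ell\le r$). An interval model is a finite multiset $\mathcal M$ of intervals; its interval count $ic(\mathcal M)$ is the number of distinct lengths $r-\ell$ of its members. An $(x,y)$-grained gadget is an interval model $\mathcal H=\mathcal{LS}\cup\mathcal{LL}\cup\mathcal{RS}\cup\mathcal{RL}$ (left short, left long, right short, right long) with $|\mathcal{LS}|=|\mathcal{RS}|=x$ and $|\mathcal{LL}|=|\mathcal{RL}|=y$, such that any two long intervals intersect, a left short interval intersects, among the other members of $\mathcal H$, exactly those in $\mathcal{LL}$, and a right short interval exactly those in $\mathcal{RL}$. An interval $I$ weakly intersects $\mathcal H$ to the left (right) if the members of $\mathcal H$ it intersects are exactly those of $\mathcal{LL}$ (of $\mathcal{RL}$), and strongly intersects $\mathcal H$ to the left if they are exactly those of $\mathcal{LS}\cup\mathcal{LL}$. Let $G$ be a cubic graph with $n$ vertices and $m$ edges, with orderings $\pi_V=(v_1,\dots,v_n)$ of $V(G)$ and $\pi_E=(e_1,\dots,e_m)$ of $E(G)$. Put $q=200n^3+1$, $p=2q+7n$, $q'=10n^2+1$, $p'=2q'+7n$.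 A model produced by the (original) reduction of Adhikary, Bose, Mukherjee and Roy from $(G,\pi_V,\pi_E)$ is an interval model consisting exactly of the following: 1. a $(p,q)$-grained gadget $\mathcal G(v_i)$ for each $i$ and a $(p',q')$-grained gadget $\mathcal G(e_j)$ for each $j$, such that $\mathcal G(v_i)$ is entirely to the left of $\mathcal G(v_{i'})$ if and only if $i<i'$, every $\mathcal G(e_j)$ is entirely to the right of every $\mathcal G(v_i)$, and $\mathcal G(e_j)$ is entirely to the left of $\mathcal G(e_{j'})$ if and only if $j<j'$; 2. for each edge $e_j=v_iv_{i'}$ with $i<i'$, four link intervals $I^1_{i,j},I^2_{i,j},I^1_{i',j},I^2_{i',j}$, where $I^1_{i,j},I^2_{i,j}$ are true twins in the intersection graph of the model, weakly intersect $\mathcal G(v_i)$ to the right and weakly intersect $\mathcal G(e_j)$ to the left, and $I^1_{i',j},I^2_{i',j}$ are true twins in that graph, weakly intersect $\mathcal G(v_{i'})$ to the right and strongly intersect $\mathcal G(e_j)$ to the left. Theorem. Let $G$ be a nonempty bridgeless cubic graph (not necessarily connected) on $n$ vertices. There are orderings $\pi_V$ of $V(G)$ and $\pi_E$ of $E(G)$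 such that (i) some model $\mathcal M$ produced by the reduction from $(G,\pi_V,\pi_E)$ satisfies $ic(\mathcal M)\le 4n/3+3$; and (ii) if $G$ is not Hamiltonian, then every model $\mathcal M$ produced by the reduction from $(G,\pi_V,\pi_E)$ satisfies $ic(\mathcal M)\ge 5$. -/

import Mathlib

noncomputable section

namespace IntervalCount

/-- A nonempty closed interval `[l, r]` of the real line (`l = r` is allowed). -/
abbrev RInterval := NonemptyInterval ℝ

/-- An interval model is a finite multiset of closed intervals. -/
abbrev IntervalModel := Multiset RInterval

/-- The interval count of a model: the number of distinct lengths `r - l` of its intervals. -/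
def intervalCount (M : IntervalModel) : ℕ :=
  (M.map NonemptyInterval.length).toFinset.card

/-- Two intervals have a nonempty intersection. -/
def Meets (I J : RInterval) : Prop :=
  ((I : Set ℝ) ∩ (J : Set ℝ)).Nonempty

/-- Two members `I`, `J` of a model are true twins in its intersection graph: they are adjacent
and have the same closed neighbourhood. -/
def TrueTwins (M : IntervalModel) (I J : RInterval) : Prop :=
  Meets I J ∧ ∀ K ∈ M, (Meets I K ↔ Meets J K)

/-- An `(x, y)`-grained gadget: `x` left short, `y` left long, `x` right short and `y` right long
intervals. The families are indexed, so that equal intervals may occur several times. -/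
structure GrainedGadget (x y : ℕ) where
  /-- the left short intervals -/
  ls : Fin x → RInterval
  /-- the left long intervals -/
  ll : Fin y → RInterval
  /-- the right short intervals -/
  rs : Fin x → RInterval
  /-- the right long intervals -/
  rl : Fin y → RInterval
  /-- any two long intervals intersect -/
  ll_ll : ∀ a b, Meets (ll a) (ll b)
  rl_rl : ∀ a b, Meets (rl a) (rl b)
  ll_rl : ∀ a b, Meets (ll a) (rl b)
  /-- a left short interval intersects, among the other intervals, exactly the left long ones -/
  ls_ll : ∀ a b, Meets (ls a) (ll b)
  ls_ls : ∀ a b, a ≠ b → ¬ Meets (ls a) (ls b)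
  ls_rs : ∀ a b, ¬ Meets (ls a) (rs b)
  ls_rl : ∀ a b, ¬ Meets (ls a) (rl b)
  /-- a right short interval intersects, among the other intervals, exactly the right long ones -/
  rs_rl : ∀ a b, Meets (rs a) (rl b)
  rs_rs : ∀ a b, a ≠ b → ¬ Meets (rs a) (rs b)
  rs_ll : ∀ a b, ¬ Meets (rs a) (ll b)

namespace GrainedGadget

variable {x y x' y' : ℕ}

/-- The multiset of all `2x + 2y` intervals of a gadget. -/
def model (H : GrainedGadget x y) : IntervalModel :=
  Finset.univ.val.map H.ls + Finset.univ.val.map H.ll +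
    Finset.univ.val.map H.rs + Finset.univ.val.map H.rl

/-- `H` lies entirely to the left of `H'`. -/
def LeftOf (H : GrainedGadget x y) (H' : GrainedGadget x' y') : Prop :=
  ∀ I ∈ H.model, ∀ J ∈ H'.model, I.snd < J.fst

end GrainedGadget

/-- `I` weakly intersects `H` to the left: it intersects exactly the left long intervals. -/
def WeaklyLeft {x y : ℕ} (I : RInterval) (H : GrainedGadget x y) : Prop :=
  (∀ a, ¬ Meets I (H.ls a)) ∧ (∀ a, Meets I (H.ll a)) ∧
    (∀ a, ¬ Meets I (H.rs a)) ∧ (∀ a, ¬ Meets I (H.rl a))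

/-- `I` weakly intersects `H` to the right: it intersects exactly the right long intervals. -/
def WeaklyRight {x y : ℕ} (I : RInterval) (H : GrainedGadget x y) : Prop :=
  (∀ a, ¬ Meets I (H.ls a)) ∧ (∀ a, ¬ Meets I (H.ll a)) ∧
    (∀ a, ¬ Meets I (H.rs a)) ∧ (∀ a, Meets I (H.rl a))

/-- `I` strongly intersects `H` to the left: it intersects exactly the left short and the left
long intervals. -/
def StronglyLeft {x y : ℕ} (I : RInterval) (H : GrainedGadget x y) : Prop :=
  (∀ a, Meets I (H.ls a)) ∧ (∀ a, Meets I (H.ll a)) ∧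
    (∀ a, ¬ Meets I (H.rs a)) ∧ (∀ a, ¬ Meets I (H.rl a))

/-- Number of long intervals on each side of a vertex gadget. -/
def vLong (n : ℕ) : ℕ := 200 * n ^ 3 + 1

/-- Number of short intervals on each side of a vertex gadget. -/
def vShort (n : ℕ) : ℕ := 2 * vLong n + 7 * n

/-- Number of long intervals on each side of an edge gadget. -/
def eLong (n : ℕ) : ℕ := 10 * n ^ 2 + 1

/-- Number of short intervals on each side of an edge gadget. -/
def eShort (n : ℕ) : ℕ := 2 * eLong n + 7 * n

/-- The pieces of a model of the original reduction, for `n` vertices and `m` edges: a gadget for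
each vertex and each edge, and for each edge `e_j = v_i v_{i'}` with `i < i'` the link intervals
`I^1_{i,j}, I^2_{i,j}` (`lower j 0`, `lower j 1`) and `I^1_{i',j}, I^2_{i',j}`
(`upper j 0`, `upper j 1`). -/
structure Pieces (n m : ℕ) where
  vGadget : Fin n → GrainedGadget (vShort n) (vLong n)
  eGadget : Fin m → GrainedGadget (eShort n) (eLong n)
  lower : Fin m → Fin 2 → RInterval
  upper : Fin m → Fin 2 → RInterval

/-- The interval model made of all the pieces. -/
def Pieces.model {n m : ℕ} (P : Pieces n m) : IntervalModel :=
  (∑ i, (P.vGadget i).model) + (∑ j, (P.eGadget j).model) +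
    (∑ j, Finset.univ.val.map (P.lower j)) + (∑ j, Finset.univ.val.map (P.upper j))

/-- The pieces are placed as the original reduction prescribes for the graph `G` and the orderings
`πV` of its vertices and `πE` of its edges. -/
structure IsPlaced {V : Type*} (G : SimpleGraph V) {n m : ℕ}
    (πV : Fin n ≃ V) (πE : Fin m ≃ G.edgeSet) (P : Pieces n m) : Prop where
  vertex_order : ∀ i i', (P.vGadget i).LeftOf (P.vGadget i') ↔ i < i'
  vertex_edge : ∀ i j, (P.vGadget i).LeftOf (P.eGadget j)
  edge_order : ∀ j j', (P.eGadget j).LeftOf (P.eGadget j') ↔ j < j'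
  lower_twins : ∀ j, TrueTwins P.model (P.lower j 0) (P.lower j 1)
  upper_twins : ∀ j, TrueTwins P.model (P.upper j 0) (P.upper j 1)
  lower_links : ∀ j i i', i < i' → (πE j : Sym2 V) = s(πV i, πV i') → ∀ c,
    WeaklyRight (P.lower j c) (P.vGadget i) ∧ WeaklyLeft (P.lower j c) (P.eGadget j)
  upper_links : ∀ j i i', i < i' → (πE j : Sym2 V) = s(πV i, πV i') → ∀ c,
    WeaklyRight (P.upper j c) (P.vGadget i') ∧ StronglyLeft (P.upper j c) (P.eGadget j)

/-- `M` is an interval model that the original reduction can produce from `G` with the vertex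
ordering `πV` and the edge ordering `πE`. -/
def IsResultingModel {V : Type*} (G : SimpleGraph V) {n m : ℕ}
    (πV : Fin n ≃ V) (πE : Fin m ≃ G.edgeSet) (M : IntervalModel) : Prop :=
  ∃ P : Pieces n m, IsPlaced G πV πE P ∧ P.model = M

end IntervalCount

end

noncomputable section

namespace IntervalCount

/-! Only the two orderings have to be chosen well. The vertices are listed along a path cover with
the fewest paths. Ends of distinct paths are then not adjacent, and counting around the first vertex
of each path gives at most `n / 3` paths (`three_mul_length_le`). Hence at least `2n / 3` vertices
are adjacent to their successor. The edges are sorted by rank: an edge from position `i` to position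
`h` has as rank the number of neighbours of `i` strictly between them.

For (i), gadgets have points and unit intervals, and are spaced evenly by `slot`. A lower link then
has a length depending on its rank alone, so at most three lengths occur. Upper links of edges
between consecutive positions share one length. The other edges number at most `m - 2n / 3`, so with
`m = 3n / 2` the total is at most `2 + 3 + 1 + 5n / 6`. This is within the bound for `n ≥ 6`; the
remaining case `n = 4` is `K₄`, where upper lengths depend on rank alone.

For (ii), positions `0, 1, 2` have forward edges of ranks `2, 1, 0`. A larger rank puts the edge
gadget further right, so their lower links are strictly nested, and they contain the gadget of
position `3`, in which a short interval lies inside a long one. This chain has five lengths. -/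

/-! ### Minimum path covers and the vertex ordering. -/

/-- A cover of the vertices by disjoint nonempty paths of `G`. -/
structure IsPathCover {V : Type*} (G : SimpleGraph V) (L : List (List V)) : Prop where
  ne_nil : ∀ P ∈ L, P ≠ []
  isChain : ∀ P ∈ L, P.IsChain G.Adj
  nodup : L.flatten.Nodup
  mem : ∀ v, v ∈ L.flatten

/-- `u` and `w` are consecutive in one of the paths. -/
def Consecutive {V : Type*} (L : List (List V)) (u w : V) : Prop :=
  ∃ P ∈ L, [u, w] <:+: P ∨ [w, u] <:+: P

/-- `u` is the first or the last vertex of `P`. -/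
def IsEnd {V : Type*} (P : List V) (u : V) : Prop :=
  P.head? = some u ∨ P.getLast? = some u

namespace IsPathCover

variable {V : Type*} {G : SimpleGraph V} {L : List (List V)}

lemma eq_of_mem (hL : IsPathCover G L) {P Q : List V} (hP : P ∈ L) (hQ : Q ∈ L) {u : V}
    (huP : u ∈ P) (huQ : u ∈ Q) : P = Q := by
  by_contra hne
  have h := (List.nodup_flatten.1 hL.nodup).2
  have : Std.Symm (List.Disjoint (α := V)) := ⟨fun _ _ h => h.symm⟩
  exact h.forall hP hQ hne huP huQ

lemma nodup_of_mem (hL : IsPathCover G L) {P : List V} (hP : P ∈ L) : P.Nodup :=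
  (List.nodup_flatten.1 hL.nodup).1 P hP

lemma exists_reorder_last {P : List V} (hc : P.IsChain G.Adj) {u : V} (hu : IsEnd P u) :
    ∃ P' : List V, P'.Perm P ∧ P'.IsChain G.Adj ∧ P'.getLast? = some u := by
  rcases hu with hu | hu
  · refine ⟨P.reverse, P.reverse_perm, ?_, by simpa using hu⟩
    rw [List.isChain_reverse]
    exact hc.imp fun _ _ h => h.symm
  · exact ⟨P, .refl _, hc, hu⟩

lemma exists_reorder_head {P : List V} (hc : P.IsChain G.Adj) {u : V} (hu : IsEnd P u) :
    ∃ P' : List V, P'.Perm P ∧ P'.IsChain G.Adj ∧ P'.head? = some u := by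
  rcases hu with hu | hu
  · exact ⟨P, .refl _, hc, hu⟩
  · refine ⟨P.reverse, P.reverse_perm, ?_, by simpa using hu⟩
    rw [List.isChain_reverse]
    exact hc.imp fun _ _ h => h.symm

/-- In a path cover with the fewest paths, ends of distinct paths are not adjacent. -/
lemma not_adj_of_isEnd [DecidableEq V] (hL : IsPathCover G L)
    (hmin : ∀ L', IsPathCover G L' → L.length ≤ L'.length) {P Q : List V} (hP : P ∈ L)
    (hQ : Q ∈ L) (hne : P ≠ Q) {u w : V} (hu : IsEnd P u) (hw : IsEnd Q w) : ¬ G.Adj u w := by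
  intro hadj
  obtain ⟨P', hP'p, hP'c, hP'u⟩ := exists_reorder_last (hL.isChain P hP) hu
  obtain ⟨Q', hQ'p, hQ'c, hQ'w⟩ := exists_reorder_head (hL.isChain Q hQ) hw
  have hQ1 : Q ∈ L.erase P := (List.mem_erase_of_ne hne.symm).2 hQ
  -- Gluing the two paths along the edge `u w` would give a cover with one path fewer.
  set R := (L.erase P).erase Q with hR
  have hperm : L.Perm (P :: Q :: R) :=
    (List.perm_cons_erase hP).trans ((List.perm_cons_erase hQ1).cons P)
  have hflat : ((P' ++ Q') :: R).flatten.Perm L.flatten := by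
    refine List.Perm.trans ?_ hperm.flatten.symm
    simp only [List.flatten_cons, List.append_assoc]
    exact hP'p.append (hQ'p.append_right _)
  have hcov : IsPathCover G ((P' ++ Q') :: R) := by
    refine ⟨?_, ?_, hflat.nodup_iff.2 hL.nodup, fun v => hflat.mem_iff.2 (hL.mem v)⟩
    · intro S hS
      rcases List.mem_cons.1 hS with rfl | hS
      · rintro h
        simp only [List.append_eq_nil_iff] at h
        simp [h.1] at hP'u
      · exact hL.ne_nil S (List.mem_of_mem_erase (List.mem_of_mem_erase hS))
    · intro S hS
      rcases List.mem_cons.1 hS with rfl | hS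
      · rw [List.isChain_append]
        refine ⟨hP'c, hQ'c, ?_⟩
        intro x hx y hy
        rw [hP'u] at hx
        rw [hQ'w] at hy
        cases hx
        cases hy
        exact hadj
      · exact hL.isChain S (List.mem_of_mem_erase (List.mem_of_mem_erase hS))
  have h1 := hmin _ hcov
  have h2 := hperm.length_eq
  simp only [List.length_cons] at h1 h2
  omega

/-- The first vertex of a path is consecutive to at most one vertex. -/
lemma consecutive_unique (hL : IsPathCover G L) {P : List V} (hP : P ∈ L) {u w w' : V}
    (hu : P.head? = some u) (hw : Consecutive L u w) (hw' : Consecutive L u w') : w = w' := by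
  have key : ∀ x, Consecutive L u x → P[1]? = some x := by
    rintro x ⟨Q, hQ, hx⟩
    have huQ : u ∈ Q := by
      rcases hx with hx | hx <;> exact hx.subset (by simp)
    obtain rfl := hL.eq_of_mem hP hQ (List.mem_of_head? hu) huQ
    have hnd := hL.nodup_of_mem hP
    rcases hx with ⟨s, t, rfl⟩ | ⟨s, t, rfl⟩
    · cases s with
      | nil => simp
      | cons a s =>
        simp only [List.cons_append, List.head?_cons, Option.some.injEq] at hu
        subst hu
        simp at hnd
    · cases s with
      | nil =>
        simp only [List.nil_append, List.cons_append, List.head?_cons, Option.some.injEq] at hu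
        subst hu
        simp at hnd
      | cons a s =>
        simp only [List.cons_append, List.head?_cons, Option.some.injEq] at hu
        subst hu
        simp at hnd
  exact Option.some.inj ((key w hw).symm.trans (key w' hw'))

/-- A vertex that is not an end of a path is consecutive to two distinct neighbours. -/
lemma exists_consecutive (hL : IsPathCover G L) {w : V} (hw : ∀ P ∈ L, ¬ IsEnd P w) :
    ∃ a b, a ≠ b ∧ G.Adj a w ∧ G.Adj b w ∧ Consecutive L a w ∧ Consecutive L b w := by
  obtain ⟨Q, hQ, hwQ⟩ := List.mem_flatten.1 (hL.mem w)
  obtain ⟨s, t, rfl⟩ := List.append_of_mem hwQ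
  have hend := hw _ hQ
  have hnd := hL.nodup_of_mem hQ
  have hc := hL.isChain _ hQ
  rcases List.eq_nil_or_concat s with rfl | ⟨s, a, rfl⟩
  · exact absurd (Or.inl (by simp)) hend
  rcases t with _ | ⟨b, t⟩
  · exact absurd (Or.inr (by simp)) hend
  have h1 : [a, w] <:+: s.concat a ++ w :: b :: t := ⟨s, b :: t, by simp⟩
  have h2 : [w, b] <:+: s.concat a ++ w :: b :: t := ⟨s.concat a, t, by simp⟩
  refine ⟨a, b, ?_, ?_, ?_, ⟨_, hQ, Or.inl h1⟩, ⟨_, hQ, Or.inr h2⟩⟩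
  · rintro rfl
    simp at hnd
    grind
  · simpa using hc.infix h1
  · exact SimpleGraph.Adj.symm (by simpa using hc.infix h2)

/-- One-vertex paths form a cover, so a least number of paths exists. -/
lemma exists_minimal (G : SimpleGraph V) [Fintype V] :
    ∃ L, IsPathCover G L ∧ ∀ L', IsPathCover G L' → L.length ≤ L'.length := by
  classical
  have hex : ∃ k, ∃ L, IsPathCover G L ∧ L.length = k := by
    refine ⟨_, Finset.univ.toList.map (fun v => [v]), ⟨?_, ?_, ?_, ?_⟩, rfl⟩
    · simp
    · simp
    · have : (Finset.univ.toList.map (fun v : V => [v])).flatten = Finset.univ.toList := by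
        rw [← List.flatMap_def]; simp
      rw [this]
      exact Finset.nodup_toList _
    · simp
  obtain ⟨L, hL, hk⟩ := Nat.find_spec hex
  exact ⟨L, hL, fun L' h' => hk ▸ Nat.find_min' hex ⟨L', h', rfl⟩⟩

/-- In a cubic graph, a path cover with the fewest paths has at most a third as many paths as
there are vertices. -/
lemma three_mul_length_le [Fintype V] [DecidableEq V] [DecidableRel G.Adj]
    (hcubic : G.IsRegularOfDegree 3) (hL : IsPathCover G L)
    (hmin : ∀ L', IsPathCover G L' → L.length ≤ L'.length) :
    3 * L.length ≤ Fintype.card V := by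
  classical
  have hLnd : L.Nodup := by
    have h := (List.nodup_flatten.1 hL.nodup).2
    refine List.Pairwise.imp_of_mem ?_ h
    rintro P Q hP _ hd rfl
    obtain ⟨u, hu⟩ := List.exists_mem_of_ne_nil _ (hL.ne_nil P hP)
    exact hd hu hu
  -- The first vertex of a path together with its neighbours off the path edges. These sets are
  -- disjoint and have at least three elements each.
  let S : List V → Finset V := fun P => Finset.univ.filter fun w =>
    ∃ u, P.head? = some u ∧ (w = u ∨ (G.Adj u w ∧ ¬ Consecutive L u w))
  have hdisj : (L.toFinset : Set (List V)).PairwiseDisjoint S := by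
    intro P hP Q hQ hne
    have hP : P ∈ L := by simpa using hP
    have hQ : Q ∈ L := by simpa using hQ
    rw [Function.onFun, Finset.disjoint_left]
    intro w hwP hwQ
    obtain ⟨u, hu, hwu⟩ := (Finset.mem_filter.1 hwP).2
    obtain ⟨v, hv, hwv⟩ := (Finset.mem_filter.1 hwQ).2
    have huv : u ≠ v := by
      rintro rfl
      exact hne (hL.eq_of_mem hP hQ (List.mem_of_head? hu) (List.mem_of_head? hv))
    have hnadj : ¬ G.Adj u v := hL.not_adj_of_isEnd hmin hP hQ hne (Or.inl hu) (Or.inl hv)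
    rcases hwu with rfl | ⟨hau, hcu⟩
    · rcases hwv with rfl | ⟨hav, -⟩
      · exact huv rfl
      · exact hnadj hav.symm
    rcases hwv with rfl | ⟨hav, hcv⟩
    · exact hnadj hau
    -- A path ending at `w` would differ from `P` or from `Q`, and `w` is adjacent to the first
    -- vertex of both.
    have hend : ∀ R ∈ L, ¬ IsEnd R w := by
      intro R hR hRw
      by_cases hPR : P = R
      · subst hPR
        exact hL.not_adj_of_isEnd hmin hQ hR hne.symm (Or.inl hv) hRw hav
      · exact hL.not_adj_of_isEnd hmin hP hR hPR (Or.inl hu) hRw hau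
    -- Two neighbours along the path of `w`, besides `u` and `v`: four in a cubic graph.
    obtain ⟨a, b, hab, haw, hbw, hca, hcb⟩ := hL.exists_consecutive hend
    have hsub : ({u, v, a, b} : Finset V) ⊆ G.neighborFinset w := by
      intro x hx
      simp only [Finset.mem_insert, Finset.mem_singleton] at hx
      rw [SimpleGraph.mem_neighborFinset]
      rcases hx with rfl | rfl | rfl | rfl
      exacts [hau.symm, hav.symm, haw.symm, hbw.symm]
    have hcard : ({u, v, a, b} : Finset V).card = 4 := by
      have h1 : u ≠ a := by rintro rfl; exact hcu hca
      have h2 : u ≠ b := by rintro rfl; exact hcu hcb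
      have h3 : v ≠ a := by rintro rfl; exact hcv hca
      have h4 : v ≠ b := by rintro rfl; exact hcv hcb
      simp [*]
    have := Finset.card_le_card hsub
    rw [hcard, SimpleGraph.card_neighborFinset_eq_degree, hcubic w] at this
    omega
  have hthree : ∀ P ∈ L.toFinset, 3 ≤ (S P).card := by
    intro P hP
    have hP : P ∈ L := by simpa using hP
    obtain ⟨u, hu⟩ : ∃ u, P.head? = some u := by
      cases P with
      | nil => exact absurd rfl (hL.ne_nil _ hP)
      | cons a P => exact ⟨a, rfl⟩
    let C := (G.neighborFinset u).filter fun w => Consecutive L u w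
    have hC : C.card ≤ 1 := by
      rw [Finset.card_le_one]
      intro x hx y hy
      exact hL.consecutive_unique hP hu (Finset.mem_filter.1 hx).2 (Finset.mem_filter.1 hy).2
    have hsub : insert u (G.neighborFinset u \ C) ⊆ S P := by
      intro w hw
      refine Finset.mem_filter.2 ⟨Finset.mem_univ _, u, hu, ?_⟩
      rcases Finset.mem_insert.1 hw with rfl | hw
      · exact Or.inl rfl
      · rw [Finset.mem_sdiff, Finset.mem_filter] at hw
        exact Or.inr ⟨by simpa using hw.1, fun h => hw.2 ⟨hw.1, h⟩⟩
    have hcard := Finset.card_le_card hsub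
    rw [Finset.card_insert_of_notMem (by simp)] at hcard
    have := Finset.le_card_sdiff C (G.neighborFinset u)
    rw [SimpleGraph.card_neighborFinset_eq_degree, hcubic u] at this
    omega
  calc 3 * L.length = L.toFinset.card * 3 := by
        rw [List.toFinset_card_of_nodup hLnd, mul_comm]
    _ = ∑ _P ∈ L.toFinset, 3 := by simp
    _ ≤ ∑ P ∈ L.toFinset, (S P).card := Finset.sum_le_sum hthree
    _ = (L.toFinset.biUnion S).card := (Finset.card_biUnion hdisj).symm
    _ ≤ Fintype.card V := Finset.card_le_univ _

/-- Along the concatenation of the paths, at most one step per path is not an edge. -/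
lemma card_breaks_le (G : SimpleGraph V) (L : List (List V)) (hc : ∀ P ∈ L, P.IsChain G.Adj)
    [∀ l : List V, DecidablePred fun i => ∃ h : i + 1 < l.length, G.Adj l[i] l[i + 1]] :
    ((Finset.range L.flatten.length).filter fun i =>
      ¬ ∃ h : i + 1 < L.flatten.length, G.Adj L.flatten[i] L.flatten[i + 1]).card
        ≤ L.length := by
  induction L with
  | nil => simp
  | cons P L ih =>
    have ih := ih fun Q hQ => hc Q (List.mem_cons_of_mem _ hQ)
    have hP := hc P List.mem_cons_self
    simp only [List.flatten_cons]
    set F := L.flatten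
    set B := (Finset.range F.length).filter fun i =>
      ¬ ∃ h : i + 1 < F.length, G.Adj F[i] F[i + 1]
    -- A break is either the last index of `P` or a break of the remaining list, shifted. The last
    -- index of the whole list counts as a break.
    have hsub : ((Finset.range (P ++ F).length).filter fun i =>
        ¬ ∃ h : i + 1 < (P ++ F).length, G.Adj (P ++ F)[i] (P ++ F)[i + 1])
        ⊆ insert (P.length - 1) (B.image (· + P.length)) := by
      intro i hi
      simp only [Finset.mem_filter, Finset.mem_range, List.length_append] at hi
      obtain ⟨hi, hbad⟩ := hi
      rw [Finset.mem_insert]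
      by_cases h1 : i + 1 < P.length
      · refine absurd ⟨by omega, ?_⟩ hbad
        rw [List.getElem_append_left (by omega), List.getElem_append_left h1]
        exact List.isChain_iff_getElem.1 hP i h1
      by_cases h2 : i < P.length
      · left; omega
      right
      refine Finset.mem_image.2 ⟨i - P.length, ?_, by omega⟩
      refine Finset.mem_filter.2 ⟨Finset.mem_range.2 (by omega), ?_⟩
      rintro ⟨h, hadj⟩
      refine hbad ⟨by omega, ?_⟩
      rw [List.getElem_append_right (by omega), List.getElem_append_right (by omega)]
      convert hadj using 2
      omega
    refine (Finset.card_le_card hsub).trans ((Finset.card_insert_le _ _).trans ?_)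
    have := Finset.card_image_le (s := B) (f := (· + P.length))
    simp only [List.length_cons]
    omega

end IsPathCover

/-- The vertices of a cubic graph can be ordered so that at most a third of them is not adjacent
to its successor. -/
lemma exists_ordering {V : Type*} [Fintype V] [DecidableEq V] (G : SimpleGraph V)
    [DecidableRel G.Adj] (hcubic : G.IsRegularOfDegree 3) :
    ∃ (π : Fin (Fintype.card V) ≃ V) (t : ℕ), 3 * t ≤ Fintype.card V ∧
      (Finset.univ.filter fun i : Fin (Fintype.card V) =>
        ¬ ∃ h : (i : ℕ) + 1 < Fintype.card V, G.Adj (π i) (π ⟨i + 1, h⟩)).card ≤ t := by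
  classical
  obtain ⟨L, hL, hmin⟩ := IsPathCover.exists_minimal G
  have hlen : L.flatten.length = Fintype.card V := by
    rw [← List.toFinset_card_of_nodup hL.nodup, ← Finset.card_univ]
    congr 1
    ext v
    simpa using hL.mem v
  let e := List.Nodup.getEquivOfForallMemList L.flatten hL.nodup hL.mem
  let π : Fin (Fintype.card V) ≃ V := (finCongr hlen.symm).trans e
  have hπ : ∀ i : Fin (Fintype.card V), π i = L.flatten[(i : ℕ)]'(by rw [hlen]; exact i.2) := fun i => rfl
  refine ⟨π, L.length, IsPathCover.three_mul_length_le hcubic hL hmin, ?_⟩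
  refine le_trans ?_ (IsPathCover.card_breaks_le G L hL.isChain)
  refine Finset.card_le_card_of_injOn (fun i => (i : ℕ)) ?_ (Fin.val_injective.injOn)
  intro i hi
  simp only [Finset.coe_filter, Finset.mem_univ, true_and, Set.mem_ofPred_eq,
    Finset.mem_range] at hi ⊢
  refine ⟨by rw [hlen]; exact i.2, ?_⟩
  rintro ⟨h, hadj⟩
  exact hi ⟨h.trans_eq hlen, by rw [hπ, hπ]; exact hadj⟩

/-! ### Ordering the edges by rank. -/

/-- A finite type can be enumerated by increasing values of an injective function. -/
lemma exists_equiv_fin_of_injective {α : Type*} [Fintype α] {f : α → ℕ}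
    (hf : Function.Injective f) {k : ℕ} (hk : Fintype.card α = k) :
    ∃ e : Fin k ≃ α, ∀ j j', f (e j) < f (e j') ↔ j < j' := by
  let : LinearOrder α := LinearOrder.lift' f hf
  exact ⟨(Fintype.orderIsoFinOfCardEq α hk).toEquiv, fun j j' =>
    (Fintype.orderIsoFinOfCardEq α hk).lt_iff_lt⟩

section Endpoints

variable {V : Type*} {G : SimpleGraph V} {n : ℕ} {π : Fin n ≃ V}

lemma exists_endpoints (π : Fin n ≃ V) (e : G.edgeSet) :
    ∃ p : Fin n × Fin n, p.1 < p.2 ∧ (e : Sym2 V) = s(π p.1, π p.2) := by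
  obtain ⟨e, he⟩ := e
  induction e with
  | h u v =>
    have hne : π.symm u ≠ π.symm v := by
      simpa using (SimpleGraph.mem_edgeSet G |>.1 he).ne
    rcases hne.lt_or_gt with h | h
    · exact ⟨(π.symm u, π.symm v), h, by simp⟩
    · exact ⟨(π.symm v, π.symm u), h, by simp [Sym2.eq_swap]⟩

/-- The earlier endpoint of an edge. -/
def lo (π : Fin n ≃ V) (e : G.edgeSet) : Fin n := (exists_endpoints π e).choose.1

/-- The later endpoint of an edge. -/
def hi (π : Fin n ≃ V) (e : G.edgeSet) : Fin n := (exists_endpoints π e).choose.2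

lemma lo_lt_hi (π : Fin n ≃ V) (e : G.edgeSet) : lo π e < hi π e :=
  (exists_endpoints π e).choose_spec.1

lemma coe_eq_lo_hi (π : Fin n ≃ V) (e : G.edgeSet) :
    (e : Sym2 V) = s(π (lo π e), π (hi π e)) :=
  (exists_endpoints π e).choose_spec.2

lemma lo_hi_eq {e : G.edgeSet} {i i' : Fin n} (hlt : i < i')
    (he : (e : Sym2 V) = s(π i, π i')) : lo π e = i ∧ hi π e = i' := by
  have h := (coe_eq_lo_hi π e).symm.trans he
  have hl := lo_lt_hi π e
  rw [Sym2.eq_iff] at h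
  rcases h with ⟨h1, h2⟩ | ⟨h1, h2⟩
  · exact ⟨π.injective h1, π.injective h2⟩
  · rw [π.injective h1, π.injective h2] at hl
    exact absurd hl hlt.asymm

end Endpoints

section EdgeOrder

variable {V : Type*} (G : SimpleGraph V) [DecidableRel G.Adj]
  {n : ℕ} (π : Fin n ≃ V)

/-- The neighbours of the `i`-th vertex that come after it. -/
def forward (i : Fin n) : Finset (Fin n) :=
  Finset.univ.filter fun x => i < x ∧ G.Adj (π i) (π x)

/-- The number of neighbours of the `i`-th vertex strictly between `i` and `h`. -/
def rank (i h : Fin n) : ℕ :=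
  ((forward G π i).filter (· < h)).card

variable {G π}

lemma mem_forward {i x : Fin n} : x ∈ forward G π i ↔ i < x ∧ G.Adj (π i) (π x) := by
  simp [forward]

lemma rank_lt_rank {i h h' : Fin n} (hh : h ∈ forward G π i) (hlt : h < h') :
    rank G π i h < rank G π i h' := by
  refine Finset.card_lt_card ((Finset.ssubset_iff_of_subset ?_).2 ⟨h, ?_, ?_⟩)
  · intro x hx
    rw [Finset.mem_filter] at hx ⊢
    exact ⟨hx.1, hx.2.trans hlt⟩
  · exact Finset.mem_filter.2 ⟨hh, hlt⟩
  · simp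

lemma rank_injOn (i : Fin n) : Set.InjOn (rank G π i) (forward G π i) := by
  intro x hx y hy hxy
  rcases lt_trichotomy x y with h | h | h
  · exact absurd hxy (rank_lt_rank hx h).ne
  · exact h
  · exact absurd hxy (rank_lt_rank hy h).ne'

lemma rank_lt_card {i h : Fin n} (hh : h ∈ forward G π i) :
    rank G π i h < (forward G π i).card := by
  refine Finset.card_lt_card ((Finset.ssubset_iff_of_subset (Finset.filter_subset _ _)).2
    ⟨h, hh, by simp⟩)

/-- Ranks are injective on the forward neighbours and smaller than their number, so every such value
is attained. -/
lemma exists_rank_eq {i : Fin n} {r : ℕ} (hr : r < (forward G π i).card) :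
    ∃ h ∈ forward G π i, rank G π i h = r := by
  have := Finset.surjOn_of_injOn_of_card_le (s := forward G π i)
    (t := Finset.range (forward G π i).card) (rank G π i)
    (fun h hh => by simpa using rank_lt_card hh) (rank_injOn i) (by simp)
  obtain ⟨h, hh, rfl⟩ := this (by simpa using hr)
  exact ⟨h, hh, rfl⟩

lemma card_neighbors [Fintype V] (hcubic : G.IsRegularOfDegree 3) (i : Fin n) :
    (Finset.univ.filter fun x => G.Adj (π i) (π x)).card = 3 := by
  rw [← hcubic (π i), ← SimpleGraph.card_neighborFinset_eq_degree]
  refine Finset.card_bij (fun x _ => π x) (by simp) (by simp) ?_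
  intro v hv
  exact ⟨π.symm v, by simpa using hv, by simp⟩

lemma card_forward_le [Fintype V] (hcubic : G.IsRegularOfDegree 3) (i : Fin n) :
    (forward G π i).card ≤ 3 := by
  rw [← card_neighbors (π := π) hcubic i]
  refine Finset.card_le_card fun x hx => ?_
  simpa using (mem_forward.1 hx).2

/-- Neighbours that do not come later are among the `i` earlier positions. -/
lemma three_le_card_forward_add [Fintype V] (hcubic : G.IsRegularOfDegree 3) (i : Fin n) :
    3 ≤ (forward G π i).card + i := by
  have hsub : (Finset.univ.filter fun x => G.Adj (π i) (π x)) ⊆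
      forward G π i ∪ Finset.Iio i := by
    intro x hx
    have hx : G.Adj (π i) (π x) := by simpa using hx
    rw [Finset.mem_union, Finset.mem_Iio, mem_forward]
    rcases lt_trichotomy i x with h | h | h
    · exact Or.inl ⟨h, hx⟩
    · subst h
      exact absurd hx (G.loopless.irrefl _)
    · exact Or.inr h
  have := (Finset.card_le_card hsub).trans (Finset.card_union_le _ _)
  rwa [card_neighbors hcubic i, Fin.card_Iio] at this

lemma hi_mem_forward (e : G.edgeSet) : hi π e ∈ forward G π (lo π e) := by
  refine mem_forward.2 ⟨lo_lt_hi π e, ?_⟩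
  have := e.2
  rwa [coe_eq_lo_hi π e, SimpleGraph.mem_edgeSet] at this

/-- The place of the gadget of an edge: edges are sorted by rank first, then by their earlier
endpoint. The first `n` places are those of the vertex gadgets. -/
def slot (π : Fin n ≃ V) (e : G.edgeSet) : ℕ :=
  lo π e + n * (rank G π (lo π e) (hi π e) + 1)

/-- The residue modulo `n` recovers the earlier endpoint and the quotient the rank, which determines
the later endpoint. -/
lemma slot_injective : Function.Injective (slot (G := G) π) := by
  intro e e' h
  have hl := (lo π e).2
  have hl' := (lo π e').2
  have h1 : lo π e = lo π e' := by
    have := congrArg (· % n) h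
    simp only [slot, Nat.add_mul_mod_self_left, Nat.mod_eq_of_lt hl, Nat.mod_eq_of_lt hl'] at this
    exact Fin.ext this
  have h2 : rank G π (lo π e) (hi π e) = rank G π (lo π e) (hi π e') := by
    rw [slot, slot, ← h1, Nat.add_left_cancel_iff] at h
    have := Nat.eq_of_mul_eq_mul_left (by omega) h
    omega
  have h3 : hi π e = hi π e' :=
    rank_injOn (lo π e) (hi_mem_forward e) (h1 ▸ hi_mem_forward e') h2
  apply Subtype.ext
  rw [coe_eq_lo_hi π e, coe_eq_lo_hi π e', h1, h3]

lemma slot_lt_slot {e e' : G.edgeSet}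
    (h : rank G π (lo π e) (hi π e) < rank G π (lo π e') (hi π e')) :
    slot π e < slot π e' := by
  have hl := (lo π e).2
  have : n * (rank G π (lo π e) (hi π e) + 1 + 1) ≤
      n * (rank G π (lo π e') (hi π e') + 1) := Nat.mul_le_mul_left _ (by omega)
  rw [slot, slot]
  rw [Nat.mul_add_one] at this
  omega

lemma le_slot (e : G.edgeSet) : n ≤ slot π e :=
  (Nat.le_mul_of_pos_right n (Nat.succ_pos _)).trans (Nat.le_add_left _ _)

lemma exists_edge_ordering [Fintype V] [DecidableEq V] (π : Fin n ≃ V) :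
    ∃ πE : Fin G.edgeFinset.card ≃ G.edgeSet,
      ∀ j j', slot π (πE j) < slot π (πE j') ↔ j < j' :=
  exists_equiv_fin_of_injective slot_injective G.edgeFinset_card.symm

/-- Each of the first vertices is the earlier endpoint of an edge of prescribed rank. -/
lemma exists_edge_rank [Fintype V] (hcubic : G.IsRegularOfDegree 3) {i : Fin n} {r : ℕ}
    (hr : r + i < 3) :
    ∃ e : G.edgeSet, lo π e = i ∧ rank G π (lo π e) (hi π e) = r := by
  have := three_le_card_forward_add (π := π) hcubic i
  obtain ⟨h, hh, hrank⟩ := exists_rank_eq (G := G) (π := π) (i := i) (r := r) (by omega)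
  have hh' := mem_forward.1 hh
  obtain ⟨h1, h2⟩ := lo_hi_eq (G := G) (π := π)
    (e := ⟨s(π i, π h), (SimpleGraph.mem_edgeSet G).2 hh'.2⟩) hh'.1 rfl
  exact ⟨_, h1, by rw [h1, h2, hrank]⟩

end EdgeOrder

/-! ### A model with few lengths. -/

lemma meets_iff {I J : RInterval} : Meets I J ↔ I.fst ≤ J.snd ∧ J.fst ≤ I.snd := by
  constructor
  · rintro ⟨x, hx, hy⟩
    have hx : I.fst ≤ x ∧ x ≤ I.snd := hx
    have hy : J.fst ≤ x ∧ x ≤ J.snd := hy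
    exact ⟨hx.1.trans hy.2, hy.1.trans hx.2⟩
  · rintro ⟨h1, h2⟩
    have hI := I.fst_le_snd
    have hJ := J.fst_le_snd
    refine ⟨max I.fst J.fst, ?_, ?_⟩
    · exact (⟨le_max_left _ _, max_le hI h2⟩ : I.fst ≤ _ ∧ _ ≤ I.snd)
    · exact (⟨le_max_right _ _, max_le h1 hJ⟩ : J.fst ≤ _ ∧ _ ≤ J.snd)

namespace GrainedGadget

lemma mem_model {x y : ℕ} {H : GrainedGadget x y} {I : RInterval} :
    I ∈ H.model ↔ (∃ a, H.ls a = I) ∨ (∃ a, H.ll a = I) ∨ (∃ a, H.rs a = I) ∨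
      (∃ a, H.rl a = I) := by
  simp [model]

end GrainedGadget

lemma Pieces.mem_model {n m : ℕ} {P : Pieces n m} {I : RInterval} :
    I ∈ P.model ↔ (∃ i, I ∈ (P.vGadget i).model) ∨ (∃ j, I ∈ (P.eGadget j).model) ∨
      (∃ j c, P.lower j c = I) ∨ (∃ j c, P.upper j c = I) := by
  simp [Pieces.model, or_assoc, Multiset.mem_sum, eq_comm (b := I)]

/-- Short intervals of the gadgets are points. The `a`-th of `x` points is at a relative position
strictly between `0` and `1`. -/
def grain (x : ℕ) (a : Fin x) : ℝ := ((a : ℝ) + 1) / ((x : ℝ) + 1)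

lemma grain_pos {x : ℕ} (a : Fin x) : 0 < grain x a := by
  unfold grain
  positivity

lemma grain_lt_one {x : ℕ} (a : Fin x) : grain x a < 1 := by
  unfold grain
  rw [div_lt_one (by positivity)]
  have : (a : ℝ) < x := by exact_mod_cast a.2
  linarith

lemma grain_injective (x : ℕ) : Function.Injective (grain x) := by
  intro a b h
  have hx : (x : ℝ) + 1 ≠ 0 := by positivity
  unfold grain at h
  rw [div_left_inj' hx, add_left_inj, Nat.cast_inj] at h
  exact Fin.ext h

/-- The gadget at `b`, with long intervals `[b, b + 1]` and `[b + 1, b + 2]` and with points as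
short intervals; the left ones lie in the first half of `[b, b + 1]`. -/
def unitGadget (x y : ℕ) (b : ℝ) : GrainedGadget x y where
  -- The halving lets an upper link ending at `b + 1 / 2` meet every left point while staying clear
  -- of the right long intervals.
  ls a := NonemptyInterval.pure (b + grain x a / 2)
  ll _ := ⟨(b, b + 1), by simp⟩
  rs a := NonemptyInterval.pure (b + 1 + grain x a)
  rl _ := ⟨(b + 1, b + 2), by norm_num⟩
  ll_ll _ _ := by simp [meets_iff]
  rl_rl _ _ := by norm_num [meets_iff]
  ll_rl _ _ := by norm_num [meets_iff]
  ls_ll a _ := by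
    have := grain_pos a
    have := grain_lt_one a
    simp only [meets_iff, NonemptyInterval.pure]
    constructor <;> linarith
  ls_ls a a' h := by
    have h' : grain x a ≠ grain x a' := (grain_injective x).ne h
    simp only [meets_iff, NonemptyInterval.pure]
    rintro ⟨h1, h2⟩
    exact h' (by linarith)
  ls_rs a a' := by
    have := grain_lt_one a
    have := grain_pos a'
    simp only [meets_iff, NonemptyInterval.pure]
    rintro ⟨h1, h2⟩
    linarith
  ls_rl a _ := by
    have := grain_lt_one a
    simp only [meets_iff, NonemptyInterval.pure]
    rintro ⟨h1, h2⟩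
    linarith
  rs_rl a _ := by
    have := grain_pos a
    have := grain_lt_one a
    simp only [meets_iff, NonemptyInterval.pure]
    constructor <;> linarith
  rs_rs a a' h := by
    have h' : grain x a ≠ grain x a' := (grain_injective x).ne h
    simp only [meets_iff, NonemptyInterval.pure]
    rintro ⟨h1, h2⟩
    exact h' (by linarith)
  rs_ll a _ := by
    have := grain_pos a
    simp only [meets_iff, NonemptyInterval.pure]
    rintro ⟨h1, h2⟩
    linarith

section UnitGadget

variable {x y : ℕ} {b : ℝ}

lemma bounds_of_mem_unitGadget {I : RInterval} (hI : I ∈ (unitGadget x y b).model) :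
    b ≤ I.fst ∧ I.snd ≤ b + 2 := by
  rcases GrainedGadget.mem_model.1 hI with ⟨a, rfl⟩ | ⟨a, rfl⟩ | ⟨a, rfl⟩ | ⟨a, rfl⟩
  · have := grain_pos a
    have := grain_lt_one a
    simp only [unitGadget, NonemptyInterval.pure]
    constructor <;> linarith
  · simp only [unitGadget]
    constructor <;> linarith
  · have := grain_pos a
    have := grain_lt_one a
    simp only [unitGadget, NonemptyInterval.pure]
    constructor <;> linarith
  · simp only [unitGadget]
    constructor <;> linarith

lemma length_of_mem_unitGadget {I : RInterval} (hI : I ∈ (unitGadget x y b).model) :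
    I.length = 0 ∨ I.length = 1 := by
  rcases GrainedGadget.mem_model.1 hI with ⟨a, rfl⟩ | ⟨a, rfl⟩ | ⟨a, rfl⟩ | ⟨a, rfl⟩
  · left; simp [unitGadget]
  · right; simp [unitGadget, NonemptyInterval.length]
  · left; simp [unitGadget]
  · right; simp only [unitGadget, NonemptyInterval.length]; ring

lemma unitGadget_leftOf {x' y' : ℕ} {b' : ℝ} (h : b + 2 < b') :
    (unitGadget x y b).LeftOf (unitGadget x' y' b') := fun I hI J hJ => by
  have := bounds_of_mem_unitGadget hI
  have := bounds_of_mem_unitGadget hJ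
  linarith

lemma unitGadget_leftOf_iff {s s' : ℕ} (hy : 0 < y) :
    (unitGadget x y (3 * (s : ℝ))).LeftOf (unitGadget x y (3 * (s' : ℝ))) ↔ s < s' := by
  constructor
  · intro h
    have hmem : ∀ b, (unitGadget x y b).ll ⟨0, hy⟩ ∈ (unitGadget x y b).model := fun b =>
      GrainedGadget.mem_model.2 (Or.inr (Or.inl ⟨_, rfl⟩))
    have := h _ (hmem _) _ (hmem _)
    simp only [unitGadget] at this
    have : (s : ℝ) < s' := by linarith
    exact_mod_cast this
  · intro h
    have : (s : ℝ) + 1 ≤ s' := by exact_mod_cast h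
    exact unitGadget_leftOf (by linarith)

/-- The link touches the right long intervals at their common right end; all points lie strictly
before it. -/
lemma weaklyRight_unitGadget {I : RInterval} (h1 : I.fst = b + 2) :
    WeaklyRight I (unitGadget x y b) := by
  have := I.fst_le_snd
  refine ⟨fun a => ?_, fun a => ?_, fun a => ?_, fun a => ?_⟩ <;>
    simp only [meets_iff, unitGadget, NonemptyInterval.pure]
  · have := grain_lt_one a
    rintro ⟨h, -⟩
    linarith
  · rintro ⟨h, -⟩
    linarith
  · have := grain_lt_one a
    rintro ⟨h, -⟩
    linarith
  · constructor <;> linarith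

lemma weaklyLeft_unitGadget {I : RInterval} (h2 : I.snd = b) :
    WeaklyLeft I (unitGadget x y b) := by
  have := I.fst_le_snd
  refine ⟨fun a => ?_, fun a => ?_, fun a => ?_, fun a => ?_⟩ <;>
    simp only [meets_iff, unitGadget, NonemptyInterval.pure]
  · have := grain_pos a
    rintro ⟨-, h⟩
    linarith
  · constructor <;> linarith
  · have := grain_pos a
    rintro ⟨-, h⟩
    linarith
  · rintro ⟨-, h⟩
    linarith

lemma stronglyLeft_unitGadget {I : RInterval} (h1 : I.fst ≤ b) (h2 : I.snd = b + 1 / 2) :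
    StronglyLeft I (unitGadget x y b) := by
  refine ⟨fun a => ?_, fun a => ?_, fun a => ?_, fun a => ?_⟩ <;>
    simp only [meets_iff, unitGadget, NonemptyInterval.pure]
  · have := grain_pos a
    have := grain_lt_one a
    constructor <;> linarith
  · constructor <;> linarith
  · have := grain_pos a
    rintro ⟨-, h⟩
    linarith
  · rintro ⟨-, h⟩
    linarith

end UnitGadget

lemma vLong_pos (n : ℕ) : 0 < vLong n := Nat.succ_pos _

lemma eLong_pos (n : ℕ) : 0 < eLong n := Nat.succ_pos _

section UnitPieces

variable {V : Type*} {G : SimpleGraph V} [DecidableRel G.Adj] {n m : ℕ}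

lemma three_mul_add_two_le_slot (π : Fin n ≃ V) (e : G.edgeSet) (i : Fin n) :
    3 * (i : ℝ) + 2 ≤ 3 * (slot π e : ℝ) := by
  have h : (i : ℕ) + 1 ≤ slot π e := le_trans i.2 (le_slot e)
  have : (i : ℝ) + 1 ≤ slot π e := by exact_mod_cast h
  linarith

/-- The pieces of a model with few lengths. -/
def unitPieces (π : Fin n ≃ V) (πE : Fin m ≃ G.edgeSet) : Pieces n m where
  -- Gadgets have width 2, so steps of 3 keep them apart.
  vGadget i := unitGadget _ _ (3 * ((i : ℕ) : ℝ))
  eGadget j := unitGadget _ _ (3 * (slot π (πE j) : ℝ))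
  lower j _ := ⟨(3 * ((lo π (πE j) : ℕ) : ℝ) + 2, 3 * (slot π (πE j) : ℝ)),
    three_mul_add_two_le_slot π _ _⟩
  upper j _ := ⟨(3 * ((hi π (πE j) : ℕ) : ℝ) + 2, 3 * (slot π (πE j) : ℝ) + 1 / 2),
    (three_mul_add_two_le_slot π (πE j) _).trans (by norm_num)⟩

lemma isPlaced_unitPieces (π : Fin n ≃ V) (πE : Fin m ≃ G.edgeSet)
    (hE : ∀ j j', slot π (πE j) < slot π (πE j') ↔ j < j') :
    IsPlaced G π πE (unitPieces π πE) where
  vertex_order i i' := unitGadget_leftOf_iff (vLong_pos n)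
  vertex_edge i j := unitGadget_leftOf (by
    have h : (i : ℕ) + 1 ≤ slot π (πE j) := le_trans i.2 (le_slot _)
    have : ((i : ℕ) : ℝ) + 1 ≤ slot π (πE j) := by exact_mod_cast h
    linarith)
  edge_order j j' := (unitGadget_leftOf_iff (eLong_pos n)).trans (hE j j')
  -- Both links of a pair are the same interval.
  lower_twins j := ⟨meets_iff.2 ⟨NonemptyInterval.fst_le_snd _, NonemptyInterval.fst_le_snd _⟩,
    fun _ _ => Iff.rfl⟩
  upper_twins j := ⟨meets_iff.2 ⟨NonemptyInterval.fst_le_snd _, NonemptyInterval.fst_le_snd _⟩,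
    fun _ _ => Iff.rfl⟩
  lower_links j i i' hlt he c := by
    obtain ⟨rfl, rfl⟩ := lo_hi_eq hlt he
    exact ⟨weaklyRight_unitGadget rfl, weaklyLeft_unitGadget rfl⟩
  upper_links j i i' hlt he c := by
    obtain ⟨rfl, rfl⟩ := lo_hi_eq hlt he
    exact ⟨weaklyRight_unitGadget rfl,
      stronglyLeft_unitGadget (three_mul_add_two_le_slot π _ _) rfl⟩

/-- The length of the upper links of an edge in `unitPieces`. -/
def upperLength (π : Fin n ≃ V) (e : G.edgeSet) : ℝ :=
  3 * (n * (rank G π (lo π e) (hi π e) + 1)) - 3 / 2 -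
    3 * (((hi π e : ℕ) : ℝ) - ((lo π e : ℕ) : ℝ))

/-- The 5 stands for lengths 0 and 1 in the gadgets and for the three possible ranks of lower links:
in the length of a lower link the earlier endpoint cancels against its contribution to `slot`. -/
lemma intervalCount_unitPieces_le [Fintype V] [DecidableEq V] (hcubic : G.IsRegularOfDegree 3)
    (π : Fin n ≃ V) (πE : Fin m ≃ G.edgeSet) :
    intervalCount (unitPieces π πE).model ≤
      5 + (Finset.univ.image (upperLength (G := G) π)).card := by
  classical
  have hsub : ((unitPieces π πE).model.map NonemptyInterval.length).toFinset ⊆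
      (({0, 1} : Finset ℝ) ∪ (Finset.range 3).image fun k : ℕ => 3 * ((n : ℝ) * (k + 1)) - 2) ∪
        Finset.univ.image (upperLength (G := G) π) := by
    intro x hx
    obtain ⟨I, hI, rfl⟩ := Multiset.mem_map.1 (Multiset.mem_toFinset.1 hx)
    simp only [Finset.mem_union, Finset.mem_insert, Finset.mem_singleton, Finset.mem_image,
      Finset.mem_range, Finset.mem_univ, true_and]
    rcases Pieces.mem_model.1 hI with ⟨i, hi⟩ | ⟨j, hj⟩ | ⟨j, c, rfl⟩ | ⟨j, c, rfl⟩
    · exact Or.inl (Or.inl (length_of_mem_unitGadget hi))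
    · exact Or.inl (Or.inl (length_of_mem_unitGadget hj))
    · refine Or.inl (Or.inr ⟨rank G π (lo π (πE j)) (hi π (πE j)), ?_, ?_⟩)
      · exact (rank_lt_card (hi_mem_forward _)).trans_le (card_forward_le hcubic _)
      · simp only [unitPieces, NonemptyInterval.length, slot]
        push_cast
        ring
    · refine Or.inr ⟨πE j, ?_⟩
      simp only [unitPieces, NonemptyInterval.length, slot, upperLength]
      push_cast
      ring
  refine (Finset.card_le_card hsub).trans ((Finset.card_union_le _ _).trans ?_)
  refine Nat.add_le_add_right ((Finset.card_union_le _ _).trans ?_) _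
  have h1 := Finset.card_le_two (a := (0 : ℝ)) (b := 1)
  have h2 := Finset.card_image_le (s := Finset.range 3)
    (f := fun k : ℕ => 3 * ((n : ℝ) * (k + 1)) - 2)
  rw [Finset.card_range] at h2
  omega

end UnitPieces

/-! ### Nested links and the lower bound. -/

/-- `I` links the gadget `H`, at its right, to the gadget `K`, at its left. -/
structure IsLink {x y x' y' : ℕ} (I : RInterval) (H : GrainedGadget x y)
    (K : GrainedGadget x' y') : Prop where
  meets_rl : ∀ a, Meets I (H.rl a)
  not_meets_ll : ∀ a, ¬ Meets I (H.ll a)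
  meets_ll : ∀ a, Meets I (K.ll a)
  not_meets_rl : ∀ a, ¬ Meets I (K.rl a)

namespace GrainedGadget

variable {x y : ℕ}

lemma ll_mem (H : GrainedGadget x y) (a : Fin y) : H.ll a ∈ H.model :=
  mem_model.2 (Or.inr (Or.inl ⟨a, rfl⟩))

lemma rl_mem (H : GrainedGadget x y) (a : Fin y) : H.rl a ∈ H.model :=
  mem_model.2 (Or.inr (Or.inr (Or.inr ⟨a, rfl⟩)))

lemma ls_mem (H : GrainedGadget x y) (a : Fin x) : H.ls a ∈ H.model :=
  mem_model.2 (Or.inl ⟨a, rfl⟩)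

end GrainedGadget

lemma length_lt_length {I J : RInterval} (h1 : J.fst < I.fst) (h2 : I.snd < J.snd) :
    I.length < J.length := by
  simp only [NonemptyInterval.length]
  linarith

/-- One of three pairwise disjoint intervals that meet `K` is shorter than `K`. -/
lemma exists_length_lt {K : RInterval} {x : ℕ} (f : Fin x → RInterval) (hx : 3 ≤ x)
    (hd : ∀ a b, a ≠ b → ¬ Meets (f a) (f b)) (hK : ∀ a, Meets (f a) K) :
    ∃ a, (f a).length < K.length := by
  -- The outer two reach into `K`, so the middle one lies strictly inside it.
  have key : ∀ a b c, (f a).snd < (f b).fst → (f b).snd < (f c).fst →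
      ∃ a, (f a).length < K.length := fun a b c h1 h2 =>
    ⟨b, length_lt_length ((meets_iff.1 (hK a)).2.trans_lt h1)
      (h2.trans_le (meets_iff.1 (hK c)).1)⟩
  have hsep : ∀ a b, a ≠ b → (f a).snd < (f b).fst ∨ (f b).snd < (f a).fst := by
    intro a b hab
    by_contra! h
    exact hd a b hab (meets_iff.2 ⟨h.2, h.1⟩)
  let a : Fin x := ⟨0, by omega⟩
  let b : Fin x := ⟨1, by omega⟩
  let c : Fin x := ⟨2, by omega⟩
  rcases hsep a b (by simp [a, b]) with h1 | h1 <;>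
    rcases hsep b c (by simp [b, c]) with h2 | h2 <;>
    rcases hsep a c (by simp [a, c]) with h3 | h3
  · exact key a b c h1 h2
  · exact key a b c h1 h2
  · exact key a c b h3 h2
  · exact key c a b h3 h1
  · exact key b a c h1 h3
  · exact key b c a h2 h3
  · exact key c b a h2 h1
  · exact key c b a h2 h1

/-- Links are nested if their gadgets are. -/
lemma IsLink.length_lt {x y x' y' : ℕ} {H H' : GrainedGadget x y} {K K' : GrainedGadget x' y'}
    (hy : 0 < y) (hy' : 0 < y') {I I' : RInterval} (hI : IsLink I H K) (hI' : IsLink I' H' K')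
    (hH : H.LeftOf H') (hHK : H'.LeftOf K') (hK : K'.LeftOf K) : I'.length < I.length := by
  let a : Fin y := ⟨0, hy⟩
  let b : Fin y' := ⟨0, hy'⟩
  apply length_lt_length
  -- `I'` misses the left long intervals of `H'` but reaches `K'`, so it starts after them; `I`
  -- starts before all of `H'`. The right ends are symmetric.
  · have h1 := (meets_iff.1 (hI.meets_rl a)).1
    have h2 := hH _ (H.rl_mem a) _ (H'.ll_mem a)
    have h3 := hI'.not_meets_ll a
    have h4 := hHK _ (H'.ll_mem a) _ (K'.ll_mem b)
    have h5 := (meets_iff.1 (hI'.meets_ll b)).2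
    have h6 := (H'.ll a).fst_le_snd
    rw [meets_iff] at h3
    by_contra! h
    exact h3 ⟨by linarith, by linarith⟩
  · have h1 := (meets_iff.1 (hI.meets_ll b)).2
    have h2 := hK _ (K'.rl_mem b) _ (K.ll_mem b)
    have h3 := hI'.not_meets_rl b
    have h4 := hHK _ (H'.rl_mem a) _ (K'.rl_mem b)
    have h5 := (meets_iff.1 (hI'.meets_rl a)).1
    have h6 := (K'.rl b).fst_le_snd
    rw [meets_iff] at h3
    by_contra! h
    exact h3 ⟨by linarith, by linarith⟩

/-- A link is longer than the intervals of a gadget between the gadgets it links. -/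
lemma IsLink.length_lt_of_mem {x y x' y' x'' y'' : ℕ} {H : GrainedGadget x y}
    {K : GrainedGadget x' y'} {M : GrainedGadget x'' y''} (hy : 0 < y) (hy' : 0 < y')
    {I J : RInterval} (hI : IsLink I H K) (hJ : J ∈ M.model) (hH : H.LeftOf M)
    (hK : M.LeftOf K) : J.length < I.length :=
  length_lt_length
    ((meets_iff.1 (hI.meets_rl ⟨0, hy⟩)).1.trans_lt (hH _ (H.rl_mem _) _ hJ))
    ((hK _ hJ _ (K.ll_mem _)).trans_le (meets_iff.1 (hI.meets_ll ⟨0, hy'⟩)).2)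

lemma five_le_card {S : Finset ℝ} {a b c d e : ℝ} (ha : a ∈ S) (hb : b ∈ S) (hc : c ∈ S)
    (hd : d ∈ S) (he : e ∈ S) (hab : a < b) (hbc : b < c) (hcd : c < d) (hde : d < e) :
    5 ≤ S.card := by
  classical
  have hsub : ({a, b, c, d, e} : Finset ℝ) ⊆ S := by
    intro x hx
    simp only [Finset.mem_insert, Finset.mem_singleton] at hx
    rcases hx with rfl | rfl | rfl | rfl | rfl <;> assumption
  have hcard : ({a, b, c, d, e} : Finset ℝ).card = 5 := by
    have := hab.trans hbc
    have := hbc.trans hcd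
    have := hcd.trans hde
    have := hab.trans (hbc.trans hcd)
    have := hbc.trans (hcd.trans hde)
    have := (hab.trans hbc).trans (hcd.trans hde)
    repeat rw [Finset.card_insert_of_notMem (by simp; grind)]
    simp
  exact hcard ▸ Finset.card_le_card hsub

/-- Sorting the edges by rank forces at least five lengths. -/
lemma five_le_intervalCount {V : Type*} [Fintype V] [DecidableEq V] {G : SimpleGraph V}
    [DecidableRel G.Adj] (hcubic : G.IsRegularOfDegree 3) {n m : ℕ} (hn : 4 ≤ n)
    {π : Fin n ≃ V} {πE : Fin m ≃ G.edgeSet}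
    (hE : ∀ j j', slot π (πE j) < slot π (πE j') ↔ j < j') {M : IntervalModel}
    (hM : IsResultingModel G π πE M) : 5 ≤ intervalCount M := by
  classical
  obtain ⟨P, hP, rfl⟩ := hM
  have hv : 0 < vLong n := vLong_pos n
  have he : 0 < eLong n := eLong_pos n
  have hlink : ∀ j, IsLink (P.lower j 0) (P.vGadget (lo π (πE j))) (P.eGadget j) := by
    intro j
    obtain ⟨h1, h2⟩ := hP.lower_links j _ _ (lo_lt_hi π (πE j)) (coe_eq_lo_hi π (πE j)) 0
    exact ⟨h1.2.2.2, h1.2.1, h2.2.1, h2.2.2.2⟩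
  -- Position `i` has at least `3 - i` forward neighbours, so rank `2 - i` occurs there.
  have hedge : ∀ i : Fin n, (i : ℕ) < 3 →
      ∃ j, lo π (πE j) = i ∧ rank G π (lo π (πE j)) (hi π (πE j)) = 2 - i := by
    intro i hi
    obtain ⟨e, h1, h2⟩ := exists_edge_rank (π := π) hcubic (i := i) (r := 2 - i) (by omega)
    exact ⟨πE.symm e, by simpa using h1, by simpa using h2⟩
  obtain ⟨j₀, hi₀, hr₀⟩ := hedge ⟨0, by omega⟩ (by simp)
  obtain ⟨j₁, hi₁, hr₁⟩ := hedge ⟨1, by omega⟩ (by simp)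
  obtain ⟨j₂, hi₂, hr₂⟩ := hedge ⟨2, by omega⟩ (by simp)
  simp only at hr₀ hr₁ hr₂
  have hlt : ∀ j j', lo π (πE j) < lo π (πE j') →
      rank G π (lo π (πE j')) (hi π (πE j')) < rank G π (lo π (πE j)) (hi π (πE j)) →
      (P.lower j' 0).length < (P.lower j 0).length := fun j j' h h' =>
    (hlink j).length_lt hv he (hlink j') ((hP.vertex_order _ _).2 h) (hP.vertex_edge _ _)
      ((hP.edge_order _ _).2 ((hE _ _).1 (slot_lt_slot h')))
  have h01 := hlt j₀ j₁ (by rw [hi₀, hi₁]; simp) (by omega)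
  have h12 := hlt j₁ j₂ (by rw [hi₁, hi₂]; simp) (by omega)
  -- This gadget lies to the right of positions `0, 1, 2` and to the left of every edge gadget,
  -- hence inside all three links.
  let H := P.vGadget ⟨3, by omega⟩
  have h23 : (H.ll ⟨0, hv⟩).length < (P.lower j₂ 0).length :=
    (hlink j₂).length_lt_of_mem hv he (H.ll_mem _)
      ((hP.vertex_order _ _).2 (by rw [hi₂]; simp)) (hP.vertex_edge _ _)
  obtain ⟨a, h34⟩ := exists_length_lt (K := H.ll ⟨0, hv⟩) H.ls (by unfold vShort; omega)
    H.ls_ls fun a => H.ls_ll a _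
  have hmem : ∀ I ∈ P.model, I.length ∈ (P.model.map NonemptyInterval.length).toFinset :=
    fun I hI => Multiset.mem_toFinset.2 (Multiset.mem_map_of_mem _ hI)
  have hlower : ∀ j, P.lower j 0 ∈ P.model := fun j =>
    Pieces.mem_model.2 (Or.inr (Or.inr (Or.inl ⟨j, 0, rfl⟩)))
  have hgadget : ∀ I ∈ H.model, I ∈ P.model := fun I hI => Pieces.mem_model.2 (Or.inl ⟨_, hI⟩)
  exact five_le_card (hmem _ (hgadget _ (H.ls_mem a))) (hmem _ (hgadget _ (H.ll_mem ⟨0, hv⟩)))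
    (hmem _ (hlower j₂)) (hmem _ (hlower j₁)) (hmem _ (hlower j₀)) h34 h23 h12 h01

/-! ### Counting the lengths of upper links. -/

/-- Edges between consecutive vertices share one upper length. -/
lemma card_image_upperLength_le {V : Type*} [Fintype V] [DecidableEq V] {G : SimpleGraph V}
    [DecidableRel G.Adj] {n : ℕ} (π : Fin n ≃ V) {t : ℕ}
    (ht : (Finset.univ.filter fun i : Fin n =>
      ¬ ∃ h : (i : ℕ) + 1 < n, G.Adj (π i) (π ⟨i + 1, h⟩)).card ≤ t) :
    (Finset.univ.image (upperLength (G := G) π)).card + n ≤ 1 + G.edgeFinset.card + t := by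
  classical
  let C := Finset.univ.filter fun e : G.edgeSet => (hi π e : ℕ) = lo π e + 1
  -- No position lies strictly between the endpoints, so the rank is 0 and the length is `3n - 3/2 -
  -- 3`.
  have hconst : ∀ e ∈ C, upperLength π e = 3 * (n : ℝ) - 9 / 2 := by
    intro e he
    have he : (hi π e : ℕ) = lo π e + 1 := (Finset.mem_filter.1 he).2
    have hr : rank G π (lo π e) (hi π e) = 0 := by
      rw [rank, Finset.card_eq_zero, Finset.filter_eq_empty_iff]
      intro x hx hlt
      have h1 := (mem_forward.1 hx).1
      rw [Fin.lt_def] at h1 hlt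
      omega
    rw [upperLength, hr, he]
    push_cast
    ring
  have hsub : Finset.univ.image (upperLength (G := G) π) ⊆
      insert (3 * (n : ℝ) - 9 / 2) (Cᶜ.image (upperLength π)) := by
    intro x hx
    obtain ⟨e, -, rfl⟩ := Finset.mem_image.1 hx
    rw [Finset.mem_insert]
    by_cases he : e ∈ C
    · exact Or.inl (hconst e he)
    · exact Or.inr (Finset.mem_image_of_mem _ (Finset.mem_compl.2 he))
  have h1 := (Finset.card_le_card hsub).trans (Finset.card_insert_le _ _)
  have h2 := Finset.card_image_le (s := Cᶜ) (f := upperLength (G := G) π)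
  have h3 := Finset.card_add_card_compl C
  have h4 : Fintype.card G.edgeSet = G.edgeFinset.card := G.edgeFinset_card.symm
  -- Each position adjacent to its successor is the earlier endpoint of an edge in `C`, so `C` has
  -- at least `n - t` edges.
  have h5 : (Finset.univ.filter fun i : Fin n =>
      ∃ h : (i : ℕ) + 1 < n, G.Adj (π i) (π ⟨i + 1, h⟩)).card ≤ C.card := by
    refine (Finset.card_le_card (t := C.image (lo π)) ?_).trans Finset.card_image_le
    intro i hi
    obtain ⟨h, hadj⟩ := (Finset.mem_filter.1 hi).2
    obtain ⟨hl, hh⟩ := lo_hi_eq (G := G) (π := π) (i := i) (i' := ⟨i + 1, h⟩)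
      (e := ⟨s(π i, π ⟨i + 1, h⟩), (SimpleGraph.mem_edgeSet G).2 hadj⟩)
      (by rw [Fin.lt_def]; simp) rfl
    exact Finset.mem_image.2
      ⟨_, Finset.mem_filter.2 ⟨Finset.mem_univ _, by rw [hl, hh]⟩, hl⟩
  have h6 := Finset.card_filter_add_card_filter_not (s := (Finset.univ : Finset (Fin n)))
    fun i => ∃ h : (i : ℕ) + 1 < n, G.Adj (π i) (π ⟨i + 1, h⟩)
  rw [Finset.card_univ, Fintype.card_fin] at h6
  omega

/-- In the complete graph on four vertices there are at most three upper lengths. -/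
lemma card_image_upperLength_le_three {V : Type*} [Fintype V] [DecidableEq V]
    {G : SimpleGraph V} [DecidableRel G.Adj] {n : ℕ} (π : Fin n ≃ V) (hn : n = 4)
    (hG : ∀ u v, u ≠ v → G.Adj u v) :
    (Finset.univ.image (upperLength (G := G) π)).card ≤ 3 := by
  classical
  have hsub : Finset.univ.image (upperLength (G := G) π) ⊆
      (Finset.range 3).image fun k : ℕ => 3 * ((n : ℝ) * (k + 1)) - 3 / 2 - 3 * (k + 1) := by
    intro x hx
    obtain ⟨e, -, rfl⟩ := Finset.mem_image.1 hx
    have hlt := lo_lt_hi π e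
    -- In a complete graph every position in between is a neighbour, so the rank determines `hi -
    -- lo`.
    have hr : rank G π (lo π e) (hi π e) = hi π e - lo π e - 1 := by
      rw [rank, ← Fin.card_Ioo]
      congr 1
      ext x
      simp only [Finset.mem_filter, mem_forward, Finset.mem_Ioo]
      exact ⟨fun h => ⟨h.1.1, h.2⟩, fun h => ⟨⟨h.1, hG _ _ (π.injective.ne h.1.ne)⟩, h.2⟩⟩
    refine Finset.mem_image.2 ⟨rank G π (lo π e) (hi π e), ?_, ?_⟩
    · rw [Finset.mem_range, hr]
      have := (hi π e).2
      omega
    · have : ((hi π e : ℕ) : ℝ) = (lo π e : ℕ) + (rank G π (lo π e) (hi π e) + 1) := by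
        rw [Fin.lt_def] at hlt
        have : (hi π e : ℕ) = (lo π e : ℕ) + (rank G π (lo π e) (hi π e) + 1) := by omega
        exact_mod_cast this
      simp only [upperLength, this]
      ring
  exact (Finset.card_le_card hsub).trans (Finset.card_image_le.trans (by simp))

end IntervalCount

end

theorem mainTheorem4 {V : Type*} [Fintype V] [DecidableEq V] [Nonempty V]
    (G : SimpleGraph V) [DecidableRel G.Adj]
    (hcubic : G.IsRegularOfDegree 3)
    (hbridgeless : ∀ e ∈ G.edgeSet, ¬ G.IsBridge e) :
    ∃ (πV : Fin (Fintype.card V) ≃ V) (πE : Fin G.edgeFinset.card ≃ G.edgeSet),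
      (∃ M, IntervalCount.IsResultingModel G πV πE M ∧
        (IntervalCount.intervalCount M : ℝ) ≤ 4 * (Fintype.card V : ℝ) / 3 + 3) ∧
      (¬ G.IsHamiltonian →
        ∀ M, IntervalCount.IsResultingModel G πV πE M → 5 ≤ IntervalCount.intervalCount M) := by
  open IntervalCount in
  obtain ⟨π, t, ht, hbreaks⟩ := exists_ordering G hcubic
  obtain ⟨πE, hE⟩ := exists_edge_ordering (G := G) π
  have hn : 4 ≤ Fintype.card V := by
    have := G.degree_lt_card_verts (Classical.arbitrary V)
    rw [hcubic] at this
    exact this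
  have hm : 3 * Fintype.card V = 2 * G.edgeFinset.card := by
    rw [← G.sum_degrees_eq_twice_card_edges, Finset.sum_congr rfl fun v _ => hcubic v]
    simp [mul_comm]
  refine ⟨π, πE, ⟨_, ⟨unitPieces π πE, isPlaced_unitPieces π πE hE, rfl⟩, ?_⟩, fun _ M hM =>
    five_le_intervalCount hcubic hn hE hM⟩
  have hcount := intervalCount_unitPieces_le hcubic π πE
  have hupper := card_image_upperLength_le π hbreaks
  -- By `hm`, `n` is even, so `n ≠ 4` means `n ≥ 6`, where `6 + 5n / 6 ≤ 4n / 3 + 3`. For `n = 4`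
  -- the general estimate is too weak, but `K₄` has at most `5 + 3 = 8` lengths and `3 * 8 ≤ 25`.
  have hbound : 3 * intervalCount (unitPieces π πE).model ≤ 4 * Fintype.card V + 9 := by
    by_cases h4 : Fintype.card V = 4
    · have hG : ∀ u v, u ≠ v → G.Adj u v := by
        intro u v huv
        have hu : G.neighborFinset u = Finset.univ.erase u := by
          refine Finset.eq_of_subset_of_card_le (fun w hw => ?_) ?_
          · rw [SimpleGraph.mem_neighborFinset] at hw
            simpa using hw.ne'
          · rw [Finset.card_erase_of_mem (Finset.mem_univ _), Finset.card_univ, h4,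
              SimpleGraph.card_neighborFinset_eq_degree, hcubic]
        rw [← SimpleGraph.mem_neighborFinset, hu]
        simpa using huv.symm
      have := card_image_upperLength_le_three π h4 hG
      omega
    · omega
  have hbound' : 3 * (intervalCount (unitPieces π πE).model : ℝ) ≤ 4 * Fintype.card V + 9 := by
    exact_mod_cast hbound
  linarith
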